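/- Let $n\ge 3$, $m\ge 1$, $\varepsilon_1,\dots,\varepsilon_n\in\{1,-1\}$, and let $g$ be the pseudo-Euclidean metric $g_{ij}=\delta_{ij}\varepsilon_i$ on $\mathbb{R}^n$. Let $\alpha_1,\dots,\alpha_n\in\mathbb{R}$ with $\sum_{i}\varepsilon_i\alpha_i^2=\pm1$ and put $\xi=\sum_i\alpha_i x_i$. Let $(F,g_F)$ be a Ricci-flat semi-Riemannian manifold of dimension $m$. Let $k,c_3>0$ be constants, and put $$S=\sqrt{m+k^2(n-1)},\qquad a=\frac{k}{S}.$$ Let $J\subseteq\mathbb{R}$ be an open set (for instance an open interval), and let $x,z$ be smooth real functions on $J$ such that, everywhere on $J$, $z+k-S>0$ and $$x=c_3\,(z+k-S)^{\frac{a-1}{2}}(z+k+S)^{-\frac{a+1}{2}},\qquad z'=-c_3\,(z+k-S)^{\frac{a+1}{2}}(z+k+S)^{-\frac{a-1}{2}}.$$ Let $\varphi,f,h$ be differentiable real functions on $J$ with $\varphi\neq0$ and $f>0$ on $J$, such that on $J$ $$\frac{\varphi'}{\varphi}=k\,\frac{f'}{f},\qquad \frac{f'}{f}=x,\qquad h'=\bigl[z+m-k(n-2)\bigr]\,x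 .$$ Let $U=\{p\in\mathbb{R}^n:\ \xi(p)\in J\}$, and regard $\varphi,f,h$ as functions on $U$ by composing with $\xi$. Then the warped product $M=(U,\overline g)\times_f F$, with $\overline g=\varphi^{-2}g$ and metric $\widetilde g=\overline g+f^2g_F$, is a steady gradient Ricci soliton with potential function $h$; that is, $\widetilde g$ is a (smooth) semi-Riemannian metric on $U\times F$, $h$ is smooth, and $$\mathrm{Ric}_{\widetilde g}+\mathrm{Hess}_{\widetilde g}(h)=0 .$$ -/

import Mathlib

open scoped Manifold ContDiff

set_option maxSynthPendingDepth 3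

noncomputable section

namespace SemiRiem

/-! ### Curvature and Hessian of a metric on an open subset of a vector space

`G u v w` is the value of the metric at the point `u` on the vectors `v`, `w`. -/

section Local

variable {E : Type*} [NormedAddCommGroup E] [NormedSpace ℝ E]

/-- The Koszul form (Christoffel symbols of the first kind):
`K u v w z = (1/2) (D_v G (w, z) + D_w G (v, z) - D_z G (v, w))` at `u`. -/
def koszul (G : E → E →L[ℝ] E →L[ℝ] ℝ) (u : E) : E →L[ℝ] E →L[ℝ] E →L[ℝ] ℝ :=
  (1 / 2 : ℝ) • (fderiv ℝ G u + (fderiv ℝ G u).flip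
    - ((ContinuousLinearMap.flipₗᵢ ℝ E E ℝ).toLinearIsometry.toContinuousLinearMap :
        (E →L[ℝ] E →L[ℝ] ℝ) →L[ℝ] (E →L[ℝ] E →L[ℝ] ℝ)) ∘L (fderiv ℝ G u).flip)

theorem koszul_apply (G : E → E →L[ℝ] E →L[ℝ] ℝ) (u v w z : E) :
    koszul G u v w z = (1 / 2 : ℝ) *
      (fderiv ℝ G u v w z + fderiv ℝ G u w v z - fderiv ℝ G u z v w) := by
  simp [koszul]

/-- The Christoffel symbols (of the second kind) of `G`: where `G u` is nondegenerate,
`christoffel G u v w` is the vector `Γ` with `G u Γ z = K u v w z` for all `z`,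
that is, the covariant derivative `∇_v w` of the constant field `w` for the Levi-Civita
connection of `G`. -/
def christoffel (G : E → E →L[ℝ] E →L[ℝ] ℝ) (u : E) : E →L[ℝ] E →L[ℝ] E :=
  (ContinuousLinearMap.compL ℝ E (E →L[ℝ] ℝ) E (G u).inverse) ∘L (koszul G u)

theorem christoffel_apply (G : E → E →L[ℝ] E →L[ℝ] ℝ) (u v w : E) :
    christoffel G u v w = (G u).inverse (koszul G u v w) := rfl

/-- The Riemann curvature `R(v, w) z = ∇_v ∇_w z - ∇_w ∇_v z` (constant fields `v, w, z`),
as a linear map in the argument `v`. -/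
def curvature (G : E → E →L[ℝ] E →L[ℝ] ℝ) (u w z : E) : E →ₗ[ℝ] E where
  toFun v := fderiv ℝ (christoffel G) u v w z - fderiv ℝ (christoffel G) u w v z
    + christoffel G u v (christoffel G u w z) - christoffel G u w (christoffel G u v z)
  map_add' v v' := by simp only [map_add, add_apply]; abel
  map_smul' c v := by
    simp only [map_smul, smul_apply, smul_add, smul_sub, RingHom.id_apply]

/-- The Ricci tensor `Ric(w, z) = tr (v ↦ R(v, w) z)`. -/
def localRicci (G : E → E →L[ℝ] E →L[ℝ] ℝ) (u w z : E) : ℝ :=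
  LinearMap.trace ℝ E (curvature G u w z)

/-- The Hessian `Hess h (v, w) = D²h (v, w) - Dh (∇_v w)` of a function `h` with respect
to `G`. -/
def localHessian (G : E → E →L[ℝ] E →L[ℝ] ℝ) (h : E → ℝ) (u v w : E) : ℝ :=
  fderiv ℝ (fderiv ℝ h) u v w - fderiv ℝ h u (christoffel G u v w)

end Local

/-! ### Metrics on manifolds

All manifolds are boundaryless, of class `C^∞` and finite dimensional; the charts are the
preferred charts `extChartAt I p`, which cover the manifold. -/

section Global

variable {E : Type*} [NormedAddCommGroup E] [NormedSpace ℝ E]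
  {H : Type*} [TopologicalSpace H] (I : ModelWithCorners ℝ E H)
  {E' : Type*} [NormedAddCommGroup E'] [NormedSpace ℝ E']
  {H' : Type*} [TopologicalSpace H'] (I' : ModelWithCorners ℝ E' H')

/-- A field of (continuous) bilinear forms on the tangent spaces of `M`. -/
abbrev BilinField (M : Type*) [TopologicalSpace M] [ChartedSpace H M] :=
  ∀ p : M, TangentSpace I p →L[ℝ] TangentSpace I p →L[ℝ] ℝ

variable {M : Type*} [TopologicalSpace M] [ChartedSpace H M]
  {M' : Type*} [TopologicalSpace M'] [ChartedSpace H' M']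

/-- The pullback `(Φ^* g)_p (v, w) = g_{Φ p} (dΦ_p v, dΦ_p w)`. -/
def pullback (Φ : M → M') (g : BilinField I' M') : BilinField I M := fun p =>
  (ContinuousLinearMap.precomp ℝ (mfderiv I I' Φ p)) ∘L (g (Φ p)) ∘L (mfderiv I I' Φ p)

theorem pullback_apply (Φ : M → M') (g : BilinField I' M') (p : M) (v w : TangentSpace I p) :
    pullback I I' Φ g p v w = g (Φ p) (mfderiv I I' Φ p v) (mfderiv I I' Φ p w) := rfl

variable {I} in
/-- The coordinate expression of `g` in the preferred chart at `p`, a function on the target of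
that chart: `u ↦ g (∂_v, ∂_w)` at the point with coordinates `u`. -/
def chartMetric (g : BilinField I M) (p : M) : E → E →L[ℝ] E →L[ℝ] ℝ := fun u =>
  pullback 𝓘(ℝ, E) I (extChartAt I p).symm g u

variable {I} in
/-- `g` is a semi-Riemannian metric: a smooth field of symmetric nondegenerate bilinear forms
of constant index. -/
structure IsSemiRiemannianMetric (g : BilinField I M) : Prop where
  symm : ∀ (p : M) (v w : TangentSpace I p), g p v w = g p w v
  nondegenerate : ∀ (p : M) (v : TangentSpace I p), (∀ w, g p v w = 0) → v = 0
  /-- The components of `g` in each of the preferred charts are smooth. -/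
  smooth : ∀ p : M, ContDiffOn ℝ ∞ (chartMetric g p) (extChartAt I p).target
  /-- Each tangent space has an orthonormal basis, with signs that do not depend on the point. -/
  constant_index : ∃ (ι : Type) (_ : Fintype ι) (η : ι → ℝ), (∀ i, η i = 1 ∨ η i = -1) ∧
    ∀ p : M, ∃ b : Module.Basis ι ℝ (TangentSpace I p),
      (∀ i, g p (b i) (b i) = η i) ∧ ∀ i j, i ≠ j → g p (b i) (b j) = 0

variable {I} in
/-- The Ricci tensor of `(M, g)` at `p`, computed in the preferred chart at `p`. -/
def ricci (g : BilinField I M) (p : M) (v w : TangentSpace I p) : ℝ :=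
  localRicci (chartMetric g p) (extChartAt I p p)
    (mfderiv I 𝓘(ℝ, E) (extChartAt I p) p v) (mfderiv I 𝓘(ℝ, E) (extChartAt I p) p w)

variable {I} in
/-- The Hessian of `h : M → ℝ` with respect to `g` at `p`, computed in the preferred chart
at `p`. -/
def hessian (g : BilinField I M) (h : M → ℝ) (p : M) (v w : TangentSpace I p) : ℝ :=
  localHessian (chartMetric g p) (h ∘ (extChartAt I p).symm) (extChartAt I p p)
    (mfderiv I 𝓘(ℝ, E) (extChartAt I p) p v) (mfderiv I 𝓘(ℝ, E) (extChartAt I p) p w)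

variable {I} in
/-- `g` is Ricci-flat. -/
def IsRicciFlat (g : BilinField I M) : Prop :=
  ∀ (p : M) (v w : TangentSpace I p), ricci g p v w = 0

variable {I} in
/-- `(M, g)` is a gradient Ricci soliton with smooth potential function `h` and constant `ρ`:
`g` is a semi-Riemannian metric and `Ric_g + Hess_g h = ρ g` on `M`. -/
structure IsGradientRicciSoliton (g : BilinField I M) (h : M → ℝ) (ρ : ℝ) : Prop where
  metric : IsSemiRiemannianMetric g
  smooth_potential : ContMDiff I 𝓘(ℝ, ℝ) ∞ h
  equation : ∀ (p : M) (v w : TangentSpace I p),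
    ricci g p v w + hessian g h p v w = ρ * g p v w

variable {I} in
/-- A steady gradient Ricci soliton is one with `ρ = 0`. -/
def IsSteadyGradientRicciSoliton (g : BilinField I M) (h : M → ℝ) : Prop :=
  IsGradientRicciSoliton g h 0

variable {I I'} in
/-- The warped product metric `g_B + f² g_F` on `B × F`. -/
def warpedProduct (gB : BilinField I M) (f : M → ℝ) (gF : BilinField I' M') :
    BilinField (I.prod I') (M × M') := fun p =>
  pullback (I.prod I') I Prod.fst gB p + (f p.1) ^ 2 • pullback (I.prod I') I' Prod.snd gF p

end Global

/-! ### Pseudo-Euclidean space -/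

/-- The pseudo-Euclidean metric `g_{ij} = δ_{ij} ε_i` on `ℝⁿ`. -/
def pseudoEuclidean {n : ℕ} (ε : Fin n → ℝ) :
    BilinField 𝓘(ℝ, EuclideanSpace ℝ (Fin n)) (EuclideanSpace ℝ (Fin n)) := fun _ =>
  (∑ i, ε i • (ContinuousLinearMap.smulRightL ℝ (EuclideanSpace ℝ (Fin n)) _
      (EuclideanSpace.proj i : EuclideanSpace ℝ (Fin n) →L[ℝ] ℝ)
      (EuclideanSpace.proj i : EuclideanSpace ℝ (Fin n) →L[ℝ] ℝ)) :
    EuclideanSpace ℝ (Fin n) →L[ℝ] EuclideanSpace ℝ (Fin n) →L[ℝ] ℝ)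

theorem pseudoEuclidean_apply {n : ℕ} (ε : Fin n → ℝ) (p v w : EuclideanSpace ℝ (Fin n)) :
    pseudoEuclidean ε p v w = ∑ i, ε i * (v i * w i) := by
  change (∑ i, ε i • (ContinuousLinearMap.smulRightL ℝ (EuclideanSpace ℝ (Fin n)) _
      (EuclideanSpace.proj i : EuclideanSpace ℝ (Fin n) →L[ℝ] ℝ)
      (EuclideanSpace.proj i : EuclideanSpace ℝ (Fin n) →L[ℝ] ℝ)) :
    EuclideanSpace ℝ (Fin n) →L[ℝ] EuclideanSpace ℝ (Fin n) →L[ℝ] ℝ) v w = _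
  simp

/-- The function `ξ(x) = ∑ α_i x_i` on `ℝⁿ`. -/
def xi {n : ℕ} (α : Fin n → ℝ) (x : EuclideanSpace ℝ (Fin n)) : ℝ := ∑ i, α i * x i

theorem continuous_xi {n : ℕ} (α : Fin n → ℝ) : Continuous (xi α) := by
  unfold xi; fun_prop

/-- The open subset `{x | ξ(x) ∈ J}` of `ℝⁿ`, for an open set `J` of real numbers. -/
def slab {n : ℕ} (α : Fin n → ℝ) (J : TopologicalSpace.Opens ℝ) :
    TopologicalSpace.Opens (EuclideanSpace ℝ (Fin n)) :=
  ⟨xi α ⁻¹' J, J.isOpen.preimage (continuous_xi α)⟩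

/-- The metric `φ(ξ)⁻² g` on `{x | ξ(x) ∈ J}`, where `g` is the pseudo-Euclidean metric. -/
def conformalMetric {n : ℕ} (ε α : Fin n → ℝ) (J : TopologicalSpace.Opens ℝ) (φ : ℝ → ℝ) :
    BilinField 𝓘(ℝ, EuclideanSpace ℝ (Fin n)) (slab α J) := fun p =>
  (1 / φ (xi α p) ^ 2) •
    pullback 𝓘(ℝ, EuclideanSpace ℝ (Fin n)) 𝓘(ℝ, EuclideanSpace ℝ (Fin n))
      (Subtype.val : slab α J → EuclideanSpace ℝ (Fin n)) (pseudoEuclidean ε) p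

end SemiRiem

end

/-!
Ricci tensor and Hessian are computed in the preferred chart at a point, so the claim is local. In
the product chart at `(p, q)` the warped product is `φ(ξ)⁻² g₀ + f(ξ)² G`, with `g₀` a constant
bilinear form and `G` the coordinate expression of `g_F` in the chart at `q`
(`chartMetric_eq_warpedForm`). With `P = φ'/φ`, `X = f'/f` and `a` the `g₀`-gradient of `ξ`, its
Christoffel symbols have base component
`-P (ξ(v₁) w₁ + ξ(w₁) v₁ - g₀(v₁, w₁) a) - X f² φ² G(v₂, w₂) a` and fibre component
`Γ_G(v₂, w₂) + X (ξ(v₁) w₂ + ξ(w₁) v₂)` (`christoffel_warped`): these vectors satisfy the defining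
Koszul identity. Every diagonal block of the curvature endomorphism is then the curvature of `G`
plus a multiple of the identity plus rank-one maps, whose traces give the Ricci tensor
(`localRicci_warped`). The chart at `q` is centred at the point under consideration, so
Ricci-flatness of `F` is used only there and no change of coordinates enters.

With `X = x` and `P = k x`, the coefficients of `g₀` and of `G` in `Ric + Hess h` are multiples of
`x' - z x²`, and that of `ξ ⊗ ξ` is `z (x' - z x²) + x (z' + x ((z + k)² - S²))`
(`localRicci_add_localHessian_eq_zero`). Both expressions vanish, by differentiation of the formula
for `x` (`hasDerivAt_profile`); the relation `a S = k` is what makes the exponents fit. Smoothness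
of `φ`, `f`, `h` follows from that of `x`, `z` through the linear equations they satisfy.
-/

namespace SemiRiem

open scoped Topology

/-! ### The local operators depend only on the germ of the metric -/

section Germ

variable {E : Type*} [NormedAddCommGroup E] [NormedSpace ℝ E]
  {G G' : E → E →L[ℝ] E →L[ℝ] ℝ} {u : E}

theorem koszul_congr (hG : G =ᶠ[𝓝 u] G') : koszul G u = koszul G' u := by
  simp only [koszul, hG.fderiv_eq]

theorem christoffel_congr (hG : G =ᶠ[𝓝 u] G') : christoffel G u = christoffel G' u := by
  simp only [christoffel, koszul_congr hG, hG.eq_of_nhds]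

theorem christoffel_eventuallyEq (hG : G =ᶠ[𝓝 u] G') :
    christoffel G =ᶠ[𝓝 u] christoffel G' :=
  hG.eventuallyEq_nhds.mono fun _ h => christoffel_congr h

theorem localRicci_congr (hG : G =ᶠ[𝓝 u] G') : localRicci G u = localRicci G' u := by
  have h : curvature G u = curvature G' u := by
    ext w z v
    simp only [curvature, (christoffel_eventuallyEq hG).fderiv_eq, christoffel_congr hG]
  funext w z
  simp only [localRicci, h]

theorem localHessian_congr {h h' : E → ℝ} (hG : G =ᶠ[𝓝 u] G') (hh : h =ᶠ[𝓝 u] h') :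
    localHessian G h u = localHessian G' h' u := by
  funext v w
  simp only [localHessian, christoffel_congr hG, hh.fderiv_eq, hh.fderiv.fderiv_eq]

end Germ

/-! ### Christoffel symbols of a nondegenerate metric -/

section Nondegenerate

variable {E : Type*} [NormedAddCommGroup E] [NormedSpace ℝ E]

/-- Differentiation commutes with evaluation of a field of bilinear maps at fixed vectors. -/
theorem fderiv_clm_apply₂ {V W Z : Type*} [NormedAddCommGroup V] [NormedSpace ℝ V]
    [NormedAddCommGroup W] [NormedSpace ℝ W] [NormedAddCommGroup Z] [NormedSpace ℝ Z]
    {T : E → V →L[ℝ] W →L[ℝ] Z} {u : E} (hT : DifferentiableAt ℝ T u) (e : E) (v : V) (w : W) :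
    fderiv ℝ T u e v w = fderiv ℝ (fun y => T y v w) u e := by
  have h1 : HasFDerivAt (fun y => T y v w) _ u :=
    (hT.hasFDerivAt.clm_apply (hasFDerivAt_const v u)).clm_apply (hasFDerivAt_const w u)
  rw [h1.fderiv]
  simp

variable {G : E → E →L[ℝ] E →L[ℝ] ℝ} {u : E}

/-- Near a point where a differentiable metric is symmetric, its Christoffel symbols are
symmetric at that point. -/
theorem christoffel_symm (hG : DifferentiableAt ℝ G u)
    (hs : ∀ᶠ y in 𝓝 u, ∀ v w, G y v w = G y w v) (v w : E) :
    christoffel G u v w = christoffel G u w v := by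
  rw [christoffel_apply, christoffel_apply]
  congr 1
  ext z
  have h : fderiv ℝ G u z v w = fderiv ℝ G u z w v := by
    rw [fderiv_clm_apply₂ hG, fderiv_clm_apply₂ hG]
    rw [Filter.EventuallyEq.fderiv_eq (hs.mono fun y hy => hy v w)]
  rw [koszul_apply, koszul_apply, h]
  ring

variable [FiniteDimensional ℝ E]

theorem isInvertible_of_nondegenerate {B : E →L[ℝ] E →L[ℝ] ℝ}
    (hB : ∀ v, (∀ w, B v w = 0) → v = 0) : B.IsInvertible := by
  let e₀ := (LinearMap.toContinuousLinearMap : (E →ₗ[ℝ] ℝ) ≃ₗ[ℝ] (E →L[ℝ] ℝ))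
  have : FiniteDimensional ℝ (E →L[ℝ] ℝ) := e₀.finiteDimensional
  have hdim : Module.finrank ℝ E = Module.finrank ℝ (E →L[ℝ] ℝ) := by
    rw [← e₀.finrank_eq]
    exact (Subspace.dual_finrank_eq (K := ℝ) (V := E)).symm
  have hinj : Function.Injective (B : E →ₗ[ℝ] E →L[ℝ] ℝ) := by
    refine (injective_iff_map_eq_zero _).2 fun v hv => hB v fun w => ?_
    change B v = 0 at hv
    simp [hv]
  refine ⟨(LinearEquiv.ofInjectiveOfFinrankEq _ hinj hdim).toContinuousLinearEquiv, ?_⟩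
  ext v w
  rfl

/-- The Koszul identity determines `∇_v w`: a vector that satisfies it is the Christoffel symbol. -/
theorem christoffel_eq_of_koszul (hB : ∀ v, (∀ w, G u v w = 0) → v = 0) {v w Γ : E}
    (h : ∀ z, G u Γ z = koszul G u v w z) : christoffel G u v w = Γ := by
  rw [christoffel_apply, (isInvertible_of_nondegenerate hB).inverse_apply_eq]
  ext z
  exact (h z).symm

theorem apply_christoffel (hB : ∀ v, (∀ w, G u v w = 0) → v = 0) (v w z : E) :
    G u (christoffel G u v w) z = koszul G u v w z := by
  rw [christoffel_apply]
  exact congrArg (· z) (((isInvertible_of_nondegenerate hB).inverse_apply_eq).1 rfl).symm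

theorem differentiableAt_christoffel (hG : ContDiffAt ℝ ∞ G u)
    (hB : ∀ v, (∀ w, G u v w = 0) → v = 0) : DifferentiableAt ℝ (christoffel G) u := by
  have : CompleteSpace E := FiniteDimensional.complete ℝ E
  obtain ⟨e, he⟩ := isInvertible_of_nondegenerate hB
  have h1 : ContDiffAt ℝ 1 (fun y => (G y).inverse) u := by
    have h := contDiffAt_map_inverse (n := 1) e
    rw [he] at h
    exact h.comp u (hG.of_le (mod_cast le_top))
  have h2 : ContDiffAt ℝ 1 (fderiv ℝ G) u :=
    (contDiffAt_infty.1 hG 2).fderiv_right (by norm_num)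
  have h3 : DifferentiableAt ℝ (koszul G) u := by
    have h4 : DifferentiableAt ℝ (fderiv ℝ G) u := h2.differentiableAt one_ne_zero
    have h5 : DifferentiableAt ℝ (fun y => (fderiv ℝ G y).flip) u :=
      (ContinuousLinearMap.flipₗᵢ ℝ E E (E →L[ℝ] ℝ)).differentiableAt.comp u h4
    unfold koszul
    exact ((h4.fun_add h5).fun_sub ((differentiableAt_const _).clm_comp h5)).fun_const_smul _
  unfold christoffel
  exact (((ContinuousLinearMap.compL ℝ E (E →L[ℝ] ℝ) E).differentiableAt.comp u
    (h1.differentiableAt one_ne_zero))).clm_comp h3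

end Nondegenerate

/-! ### Christoffel symbols of a warped product in coordinates -/

section LocalWarped

variable {E₁ : Type*} [NormedAddCommGroup E₁] [NormedSpace ℝ E₁]
  {E₂ : Type*} [NormedAddCommGroup E₂] [NormedSpace ℝ E₂]

/-- The metric `φ(ξ)⁻² g₀ + f(ξ)² GF` on (an open subset of) `E₁ × E₂`, where `g₀` is a constant
bilinear form on `E₁`, `ξ` a linear form on `E₁`, and `GF` a metric on (an open subset of) `E₂`. -/
noncomputable def warpedForm (g₀ : E₁ →L[ℝ] E₁ →L[ℝ] ℝ) (ξ : E₁ →L[ℝ] ℝ) (φ f : ℝ → ℝ)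
    (GF : E₂ → E₂ →L[ℝ] E₂ →L[ℝ] ℝ) : E₁ × E₂ → (E₁ × E₂) →L[ℝ] (E₁ × E₂) →L[ℝ] ℝ := fun u =>
  (1 / φ (ξ u.1) ^ 2) • ((ContinuousLinearMap.precomp ℝ (ContinuousLinearMap.fst ℝ E₁ E₂)) ∘L
      g₀ ∘L (ContinuousLinearMap.fst ℝ E₁ E₂))
    + f (ξ u.1) ^ 2 • ((ContinuousLinearMap.precomp ℝ (ContinuousLinearMap.snd ℝ E₁ E₂)) ∘L
      GF u.2 ∘L (ContinuousLinearMap.snd ℝ E₁ E₂))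

variable {g₀ : E₁ →L[ℝ] E₁ →L[ℝ] ℝ} {ξ : E₁ →L[ℝ] ℝ} {a : E₁} {J : Set ℝ} {φ f P X : ℝ → ℝ}
  {V : Set E₂} {GF : E₂ → E₂ →L[ℝ] E₂ →L[ℝ] ℝ}

theorem warpedForm_apply (u v w : E₁ × E₂) :
    warpedForm g₀ ξ φ f GF u v w =
      1 / φ (ξ u.1) ^ 2 * g₀ v.1 w.1 + f (ξ u.1) ^ 2 * GF u.2 v.2 w.2 := by
  simp [warpedForm]

/-- The standing assumptions on `warpedForm g₀ ξ φ f GF` over `{u | ξ u.1 ∈ J, u.2 ∈ V}`: `a` is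
the gradient of `ξ` for `g₀`, and `P`, `X` are the logarithmic derivatives of `φ`, `f`. -/
structure IsWarpedData (g₀ : E₁ →L[ℝ] E₁ →L[ℝ] ℝ) (ξ : E₁ →L[ℝ] ℝ) (a : E₁) (J : Set ℝ)
    (φ f P X : ℝ → ℝ) (V : Set E₂) (GF : E₂ → E₂ →L[ℝ] E₂ →L[ℝ] ℝ) : Prop where
  base_symm : ∀ v w, g₀ v w = g₀ w v
  base_nondegenerate : ∀ v, (∀ w, g₀ v w = 0) → v = 0
  gradient : ∀ w, g₀ a w = ξ w
  isOpen_interval : IsOpen J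
  smooth_conformal : ContDiffOn ℝ ∞ φ J
  smooth_warping : ContDiffOn ℝ ∞ f J
  conformal_ne_zero : ∀ t ∈ J, φ t ≠ 0
  warping_ne_zero : ∀ t ∈ J, f t ≠ 0
  deriv_conformal : ∀ t ∈ J, HasDerivAt φ (P t * φ t) t
  deriv_warping : ∀ t ∈ J, HasDerivAt f (X t * f t) t
  isOpen_fiber : IsOpen V
  smooth_fiber : ContDiffOn ℝ ∞ GF V
  fiber_symm : ∀ y ∈ V, ∀ v w, GF y v w = GF y w v
  fiber_nondegenerate : ∀ y ∈ V, ∀ v, (∀ w, GF y v w = 0) → v = 0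

namespace IsWarpedData

variable (D : IsWarpedData g₀ ξ a J φ f P X V GF) {u : E₁ × E₂}
include D

theorem nondegenerate (hJ : ξ u.1 ∈ J) (hV : u.2 ∈ V) (v : E₁ × E₂)
    (hv : ∀ w, warpedForm g₀ ξ φ f GF u v w = 0) : v = 0 := by
  have hφ := D.conformal_ne_zero _ hJ
  have hf := D.warping_ne_zero _ hJ
  refine Prod.ext (D.base_nondegenerate _ fun w => ?_) (D.fiber_nondegenerate _ hV _ fun w => ?_)
  · simpa [warpedForm_apply, hφ] using hv (w, 0)
  · simpa [warpedForm_apply, hf] using hv (0, w)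

theorem contDiffOn :
    ContDiffOn ℝ ∞ (warpedForm g₀ ξ φ f GF) {u | ξ u.1 ∈ J ∧ u.2 ∈ V} := by
  have hξ : ContDiff ℝ ∞ fun u : E₁ × E₂ => ξ u.1 := ξ.contDiff.comp contDiff_fst
  have h1 := D.smooth_conformal.comp (s := {u : E₁ × E₂ | ξ u.1 ∈ J ∧ u.2 ∈ V}) hξ.contDiffOn
    fun u hu => hu.1
  have h2 := D.smooth_warping.comp (s := {u : E₁ × E₂ | ξ u.1 ∈ J ∧ u.2 ∈ V}) hξ.contDiffOn
    fun u hu => hu.1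
  have h3 := D.smooth_fiber.comp (s := {u : E₁ × E₂ | ξ u.1 ∈ J ∧ u.2 ∈ V})
    contDiff_snd.contDiffOn fun u hu => hu.2
  refine ContDiffOn.add (ContDiffOn.fun_smul ?_ contDiffOn_const)
    (ContDiffOn.fun_smul (h2.pow 2) ?_)
  · exact contDiffOn_const.div (h1.pow 2) fun u hu => pow_ne_zero _ (D.conformal_ne_zero _ hu.1)
  · exact contDiffOn_const.clm_comp (h3.clm_comp contDiffOn_const)

theorem mem_nhds (hJ : ξ u.1 ∈ J) (hV : u.2 ∈ V) :
    {u : E₁ × E₂ | ξ u.1 ∈ J ∧ u.2 ∈ V} ∈ 𝓝 u :=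
  ((D.isOpen_interval.preimage (ξ.continuous.comp continuous_fst)).inter
    (D.isOpen_fiber.preimage continuous_snd)).mem_nhds ⟨hJ, hV⟩

theorem contDiffAt (hJ : ξ u.1 ∈ J) (hV : u.2 ∈ V) :
    ContDiffAt ℝ ∞ (warpedForm g₀ ξ φ f GF) u :=
  D.contDiffOn.contDiffAt (D.mem_nhds hJ hV)

theorem contDiffAt_fiber {y : E₂} (hV : y ∈ V) : ContDiffAt ℝ ∞ GF y :=
  D.smooth_fiber.contDiffAt (D.isOpen_fiber.mem_nhds hV)

theorem fderiv_apply (hJ : ξ u.1 ∈ J) (hV : u.2 ∈ V) (v w z : E₁ × E₂) :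
    fderiv ℝ (warpedForm g₀ ξ φ f GF) u v w z =
      -2 * P (ξ u.1) / φ (ξ u.1) ^ 2 * ξ v.1 * g₀ w.1 z.1
      + 2 * X (ξ u.1) * f (ξ u.1) ^ 2 * ξ v.1 * GF u.2 w.2 z.2
      + f (ξ u.1) ^ 2 * fderiv ℝ GF u.2 v.2 w.2 z.2 := by
  have hφ := D.conformal_ne_zero _ hJ
  have hGF := (D.contDiffAt_fiber hV).differentiableAt (by simp)
  rw [fderiv_clm_apply₂ ((D.contDiffAt hJ hV).differentiableAt (by simp))]
  simp only [warpedForm_apply]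
  have hξ : HasFDerivAt (fun u : E₁ × E₂ => ξ u.1) (ξ ∘L .fst ℝ E₁ E₂) u :=
    ξ.hasFDerivAt.comp u hasFDerivAt_fst
  have h1 : HasDerivAt (fun t => 1 / φ t ^ 2) (-2 * P (ξ u.1) / φ (ξ u.1) ^ 2) (ξ u.1) := by
    have h := (hasDerivAt_const (ξ u.1) (1 : ℝ)).fun_div ((D.deriv_conformal _ hJ).fun_pow 2)
      (pow_ne_zero 2 hφ)
    refine h.congr_deriv ?_
    field_simp
    push_cast
    ring
  have h2 : HasDerivAt (fun t => f t ^ 2) (2 * X (ξ u.1) * f (ξ u.1) ^ 2) (ξ u.1) := by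
    refine ((D.deriv_warping _ hJ).fun_pow 2).congr_deriv ?_
    push_cast
    ring
  have h3 : HasFDerivAt (fun y : E₁ × E₂ => GF y.2) (fderiv ℝ GF u.2 ∘L .snd ℝ E₁ E₂) u :=
    HasFDerivAt.comp u hGF.hasFDerivAt hasFDerivAt_snd
  have h4 := (h3.clm_apply (hasFDerivAt_const w.2 u)).clm_apply (hasFDerivAt_const z.2 u)
  have h5 := ((h1.comp_hasFDerivAt u hξ).fun_mul (hasFDerivAt_const (g₀ w.1 z.1) u)).fun_add
    ((h2.comp_hasFDerivAt u hξ).fun_mul h4)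
  simp only [Function.comp_def] at h5
  rw [h5.fderiv]
  simp
  ring

variable [FiniteDimensional ℝ E₁] [FiniteDimensional ℝ E₂]

/-- The Christoffel symbols of the warped product. The base component is that of the conformally
flat metric `φ⁻² g₀` minus the normal part of the fibres, the fibre component is that of `GF` plus
the derivative of `log f`. -/
theorem christoffel_warped (hJ : ξ u.1 ∈ J) (hV : u.2 ∈ V) (v w : E₁ × E₂) :
    christoffel (warpedForm g₀ ξ φ f GF) u v w =
      (-P (ξ u.1) • (ξ v.1 • w.1 + ξ w.1 • v.1 - g₀ v.1 w.1 • a)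
          - (X (ξ u.1) * (f (ξ u.1) ^ 2 * φ (ξ u.1) ^ 2) * GF u.2 v.2 w.2) • a,
        christoffel GF u.2 v.2 w.2 + X (ξ u.1) • (ξ v.1 • w.2 + ξ w.1 • v.2)) := by
  have hφ := D.conformal_ne_zero _ hJ
  have hK := fun z => apply_christoffel (D.fiber_nondegenerate _ hV) v.2 w.2 z
  refine christoffel_eq_of_koszul (D.nondegenerate hJ hV) fun z => ?_
  simp only [koszul_apply] at hK
  rw [koszul_apply, D.fderiv_apply hJ hV, D.fderiv_apply hJ hV, D.fderiv_apply hJ hV,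
    warpedForm_apply]
  simp only [map_add, map_sub, map_smul, add_apply, sub_apply,
    smul_apply, smul_eq_mul, D.gradient, hK]
  rw [D.fiber_symm _ hV w.2 z.2, D.fiber_symm _ hV v.2 z.2]
  field_simp
  ring

end IsWarpedData

end LocalWarped

/-! ### Ricci tensor and Hessian of a warped product in coordinates -/

section Trace

variable {A B : Type*} [AddCommGroup A] [Module ℝ A] [FiniteDimensional ℝ A]
  [AddCommGroup B] [Module ℝ B] [FiniteDimensional ℝ B]

/-- The trace of an endomorphism of a product is the sum of the traces of its diagonal blocks. -/
theorem trace_prod_eq_add (T : (A × B) →ₗ[ℝ] (A × B)) :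
    LinearMap.trace ℝ (A × B) T =
      LinearMap.trace ℝ A (LinearMap.fst ℝ A B ∘ₗ T ∘ₗ LinearMap.inl ℝ A B) +
      LinearMap.trace ℝ B (LinearMap.snd ℝ A B ∘ₗ T ∘ₗ LinearMap.inr ℝ A B) := by
  have h : T = (T ∘ₗ LinearMap.inl ℝ A B) ∘ₗ LinearMap.fst ℝ A B +
      (T ∘ₗ LinearMap.inr ℝ A B) ∘ₗ LinearMap.snd ℝ A B := by
    ext <;> simp [← Prod.zero_eq_mk]
  conv_lhs => rw [h]
  rw [map_add, LinearMap.trace_comp_comm' (T ∘ₗ _),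
    LinearMap.trace_comp_comm' (T ∘ₗ LinearMap.inr ℝ A B)]

end Trace

section LocalWarped

variable {E₁ : Type*} [NormedAddCommGroup E₁] [NormedSpace ℝ E₁] [FiniteDimensional ℝ E₁]
  {E₂ : Type*} [NormedAddCommGroup E₂] [NormedSpace ℝ E₂] [FiniteDimensional ℝ E₂]
  {g₀ : E₁ →L[ℝ] E₁ →L[ℝ] ℝ} {ξ : E₁ →L[ℝ] ℝ} {a : E₁} {J : Set ℝ} {φ f P X : ℝ → ℝ}
  {V : Set E₂} {GF : E₂ → E₂ →L[ℝ] E₂ →L[ℝ] ℝ} {u : E₁ × E₂} {P' X' : ℝ}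

namespace IsWarpedData

variable (D : IsWarpedData g₀ ξ a J φ f P X V GF)
include D

/-- The derivative of `christoffel_warped`, with `P'` and `X'` the derivatives of `P` and `X`. -/
theorem fderiv_christoffel_apply (hJ : ξ u.1 ∈ J) (hV : u.2 ∈ V) (hP : HasDerivAt P P' (ξ u.1))
    (hX : HasDerivAt X X' (ξ u.1)) (v w z : E₁ × E₂) :
    fderiv ℝ (christoffel (warpedForm g₀ ξ φ f GF)) u v w z =
      (-(P' * ξ v.1) • (ξ w.1 • z.1 + ξ z.1 • w.1 - g₀ w.1 z.1 • a)
          - (f (ξ u.1) ^ 2 * φ (ξ u.1) ^ 2 *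
            ((X' + 2 * X (ξ u.1) ^ 2 + 2 * X (ξ u.1) * P (ξ u.1)) * ξ v.1 * GF u.2 w.2 z.2
              + X (ξ u.1) * fderiv ℝ GF u.2 v.2 w.2 z.2)) • a,
        fderiv ℝ (christoffel GF) u.2 v.2 w.2 z.2
          + (X' * ξ v.1) • (ξ w.1 • z.2 + ξ z.1 • w.2)) := by
  have hdiff : DifferentiableAt ℝ (christoffel (warpedForm g₀ ξ φ f GF)) u :=
    differentiableAt_christoffel (D.contDiffAt hJ hV) (D.nondegenerate hJ hV)
  have hGF := (D.contDiffAt_fiber hV).differentiableAt (by simp)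
  have hΓ : DifferentiableAt ℝ (christoffel GF) u.2 :=
    differentiableAt_christoffel (D.contDiffAt_fiber hV) (D.fiber_nondegenerate _ hV)
  have heq : (fun y => christoffel (warpedForm g₀ ξ φ f GF) y w z) =ᶠ[𝓝 u] fun y =>
      (-P (ξ y.1) • (ξ w.1 • z.1 + ξ z.1 • w.1 - g₀ w.1 z.1 • a)
          - (X (ξ y.1) * (f (ξ y.1) ^ 2 * φ (ξ y.1) ^ 2) * GF y.2 w.2 z.2) • a,
        christoffel GF y.2 w.2 z.2 + X (ξ y.1) • (ξ w.1 • z.2 + ξ z.1 • w.2)) := by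
    filter_upwards [D.mem_nhds hJ hV] with y hy
    exact D.christoffel_warped hy.1 hy.2 w z
  rw [fderiv_clm_apply₂ hdiff, heq.fderiv_eq]
  have hξ : HasFDerivAt (fun u : E₁ × E₂ => ξ u.1) (ξ ∘L .fst ℝ E₁ E₂) u :=
    ξ.hasFDerivAt.comp u hasFDerivAt_fst
  have hQ : HasDerivAt (fun t => X t * (f t ^ 2 * φ t ^ 2)) (f (ξ u.1) ^ 2 * φ (ξ u.1) ^ 2 *
      (X' + 2 * X (ξ u.1) ^ 2 + 2 * X (ξ u.1) * P (ξ u.1))) (ξ u.1) := by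
    refine (hX.fun_mul (((D.deriv_warping _ hJ).fun_pow 2).fun_mul
      ((D.deriv_conformal _ hJ).fun_pow 2))).congr_deriv ?_
    push_cast
    ring
  have h1 : HasFDerivAt (fun y : E₁ × E₂ => GF y.2) (fderiv ℝ GF u.2 ∘L .snd ℝ E₁ E₂) u :=
    HasFDerivAt.comp u hGF.hasFDerivAt hasFDerivAt_snd
  have h2 := (h1.clm_apply (hasFDerivAt_const w.2 u)).clm_apply (hasFDerivAt_const z.2 u)
  have h3 : HasFDerivAt (fun y : E₁ × E₂ => christoffel GF y.2)
      (fderiv ℝ (christoffel GF) u.2 ∘L .snd ℝ E₁ E₂) u :=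
    HasFDerivAt.comp u hΓ.hasFDerivAt hasFDerivAt_snd
  have h4 := (h3.clm_apply (hasFDerivAt_const w.2 u)).clm_apply (hasFDerivAt_const z.2 u)
  have h5 := ((hP.comp_hasFDerivAt u hξ).fun_neg.smul_const
      (ξ w.1 • z.1 + ξ z.1 • w.1 - g₀ w.1 z.1 • a)).fun_sub
    (((hQ.comp_hasFDerivAt u hξ).fun_mul h2).smul_const a)
  have h6 := h4.fun_add ((hX.comp_hasFDerivAt u hξ).smul_const (ξ w.1 • z.2 + ξ z.1 • w.2))
  have h7 := h5.prodMk h6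
  simp only [Function.comp_def] at h7
  rw [h7.fderiv]
  refine Prod.ext ?_ ?_
  · simp
    module
  · simp

/-- The Ricci tensor of the warped product, by components along `ξ ⊗ ξ`, along `g₀` and along the
fibre; `P'` and `X'` are the derivatives of `P = φ'/φ` and `X = f'/f`. -/
theorem localRicci_warped (hJ : ξ u.1 ∈ J) (hV : u.2 ∈ V) (hP : HasDerivAt P P' (ξ u.1))
    (hX : HasDerivAt X X' (ξ u.1)) (w z : E₁ × E₂) :
    localRicci (warpedForm g₀ ξ φ f GF) u w z =
      localRicci GF u.2 w.2 z.2
      + ((Module.finrank ℝ E₁ - 2) * (P' + P (ξ u.1) ^ 2)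
          - Module.finrank ℝ E₂ * (X' + 2 * X (ξ u.1) * P (ξ u.1) + X (ξ u.1) ^ 2))
        * (ξ w.1 * ξ z.1)
      + ξ a * (P' - (Module.finrank ℝ E₁ - 2) * P (ξ u.1) ^ 2
          + Module.finrank ℝ E₂ * X (ξ u.1) * P (ξ u.1)) * g₀ w.1 z.1
      + ξ a * (f (ξ u.1) ^ 2 * φ (ξ u.1) ^ 2) * (-X' + (Module.finrank ℝ E₁ - 2)
          * P (ξ u.1) * X (ξ u.1) - Module.finrank ℝ E₂ * X (ξ u.1) ^ 2) * GF u.2 w.2 z.2 := by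
  have hsymm := christoffel_symm ((D.contDiffAt_fiber hV).differentiableAt (by simp))
    (Filter.eventually_of_mem (D.isOpen_fiber.mem_nhds hV) D.fiber_symm)
  have hF := D.fiber_symm _ hV
  set p := P (ξ u.1) with hp
  set x := X (ξ u.1) with hx
  set s := f (ξ u.1) ^ 2 * φ (ξ u.1) ^ 2 with hs
  set A := ξ w.1 with hA
  set B := ξ z.1 with hB
  set b := g₀ w.1 z.1 with hb
  set c := GF u.2 w.2 z.2 with hc
  -- the base component of `∇_w z`
  set Γ : E₁ := -p • (A • z.1 + B • w.1 - b • a) - (x * s * c) • a with hΓ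
  -- the endomorphism is a multiple of the identity plus maps of rank one, which have known traces
  have hbase : LinearMap.fst ℝ E₁ E₂ ∘ₗ curvature (warpedForm g₀ ξ φ f GF) u w z ∘ₗ
      LinearMap.inl ℝ E₁ E₂ =
      (ξ : E₁ →ₗ[ℝ] ℝ).smulRight (-P' • (B • w.1 - b • a)
        - ((X' + 2 * x ^ 2 + 2 * x * p) * s * c) • a - p • Γ - (p ^ 2 * A) • z.1
        - (2 * p ^ 2 * B) • w.1 + (p ^ 2 * b + x ^ 2 * s * c) • a)
      + (P' * A * B - p * ξ Γ - p ^ 2 * A * B) • LinearMap.id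
      + (g₀ z.1 : E₁ →ₗ[ℝ] ℝ).smulRight (-(P' * A) • a + (p ^ 2 * ξ a) • w.1)
      + (g₀ Γ : E₁ →ₗ[ℝ] ℝ).smulRight (p • a)
      + (g₀ w.1 : E₁ →ₗ[ℝ] ℝ).smulRight ((p ^ 2 * B) • a) := by
    ext v
    have hzw : g₀ v z.1 = g₀ z.1 v := D.base_symm _ _
    have hvΓ : g₀ v Γ = g₀ Γ v := D.base_symm _ _
    have hwa : g₀ w.1 a = A := by rw [D.base_symm, D.gradient]
    change (fderiv ℝ (christoffel (warpedForm g₀ ξ φ f GF)) u (v, 0) w z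
      - fderiv ℝ (christoffel (warpedForm g₀ ξ φ f GF)) u w (v, 0) z
      + christoffel (warpedForm g₀ ξ φ f GF) u (v, 0)
        (christoffel (warpedForm g₀ ξ φ f GF) u w z)
      - christoffel (warpedForm g₀ ξ φ f GF) u w
        (christoffel (warpedForm g₀ ξ φ f GF) u (v, 0) z)).1 = _
    rw [D.fderiv_christoffel_apply hJ hV hP hX, D.fderiv_christoffel_apply hJ hV hP hX,
      D.christoffel_warped hJ hV w z, D.christoffel_warped hJ hV (v, 0) z,
      D.christoffel_warped hJ hV (v, 0), D.christoffel_warped hJ hV w]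
    simp only [← hp, ← hx, ← hs, ← hA, ← hB, ← hb, ← hc, ← hΓ, hzw, hvΓ, hwa,
      Prod.fst_add, Prod.fst_sub, map_add, map_sub, map_smul, map_zero, zero_apply, smul_eq_mul]
    simp only [LinearMap.add_apply, LinearMap.smulRight_apply, LinearMap.smul_apply,
      LinearMap.id_apply, ContinuousLinearMap.coe_coe]
    module
  -- the terms `ΓF(v, w)` and `ΓF(w, v)` that come from the warping cancel by symmetry of `ΓF`
  have hfiber : LinearMap.snd ℝ E₁ E₂ ∘ₗ curvature (warpedForm g₀ ξ φ f GF) u w z ∘ₗ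
      LinearMap.inr ℝ E₁ E₂ = curvature GF u.2 w.2 z.2
      + (-X' * A * B + x * ξ Γ - x ^ 2 * A * B) • LinearMap.id
      + (GF u.2 z.2 : E₂ →ₗ[ℝ] ℝ).smulRight ((x ^ 2 * s * ξ a) • w.2) := by
    ext v
    change (fderiv ℝ (christoffel (warpedForm g₀ ξ φ f GF)) u (0, v) w z
      - fderiv ℝ (christoffel (warpedForm g₀ ξ φ f GF)) u w (0, v) z
      + christoffel (warpedForm g₀ ξ φ f GF) u (0, v)
        (christoffel (warpedForm g₀ ξ φ f GF) u w z)
      - christoffel (warpedForm g₀ ξ φ f GF) u w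
        (christoffel (warpedForm g₀ ξ φ f GF) u (0, v) z)).2 =
      fderiv ℝ (christoffel GF) u.2 v w.2 z.2
      - fderiv ℝ (christoffel GF) u.2 w.2 v z.2
      + christoffel GF u.2 v (christoffel GF u.2 w.2 z.2)
      - christoffel GF u.2 w.2 (christoffel GF u.2 v z.2) + _ + _
    rw [D.fderiv_christoffel_apply hJ hV hP hX, D.fderiv_christoffel_apply hJ hV hP hX,
      D.christoffel_warped hJ hV w z, D.christoffel_warped hJ hV (0, v) z,
      D.christoffel_warped hJ hV (0, v), D.christoffel_warped hJ hV w]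
    simp only [← hp, ← hx, ← hs, ← hA, ← hB, ← hb, ← hc, ← hΓ, hsymm v w.2,
      hF v z.2, Prod.snd_add, Prod.snd_sub, map_add, map_sub, map_smul, map_zero, zero_apply,
      smul_eq_mul]
    simp only [LinearMap.smulRight_apply, LinearMap.smul_apply,
      LinearMap.id_apply, ContinuousLinearMap.coe_coe]
    module
  rw [localRicci, trace_prod_eq_add, hbase, hfiber]
  have hzw : g₀ z.1 w.1 = b := D.base_symm _ _
  have hza : g₀ z.1 a = B := by rw [D.base_symm, D.gradient]
  have hwa : g₀ w.1 a = A := by rw [D.base_symm, D.gradient]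
  have hzw' : GF u.2 z.2 w.2 = c := hF _ _
  have hΓa : g₀ Γ a = ξ Γ := by rw [D.base_symm, D.gradient]
  have hξΓ : ξ Γ = -p * (2 * A * B - b * ξ a) - x * s * c * ξ a := by
    simp only [hΓ, map_sub, map_add, map_smul, smul_eq_mul, ← hA, ← hB]
    ring
  simp only [map_add, map_sub, map_smul, LinearMap.trace_smulRight, LinearMap.trace_id,
    ContinuousLinearMap.coe_coe, smul_eq_mul, hza, hwa, hzw, hzw', hΓa, hξΓ, ← hA, ← hB,
    localRicci]
  ring

/-- The Hessian of a function of `ξ` for the warped product. -/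
theorem localHessian_warped (hJ : ξ u.1 ∈ J) (hV : u.2 ∈ V) {h : ℝ → ℝ}
    (hh : ContDiffOn ℝ ∞ h J) (w z : E₁ × E₂) :
    localHessian (warpedForm g₀ ξ φ f GF) (fun y => h (ξ y.1)) u w z =
      deriv (deriv h) (ξ u.1) * (ξ w.1 * ξ z.1)
      + deriv h (ξ u.1) * (P (ξ u.1) * (2 * (ξ w.1 * ξ z.1) - ξ a * g₀ w.1 z.1)
        + ξ a * (f (ξ u.1) ^ 2 * φ (ξ u.1) ^ 2) * X (ξ u.1) * GF u.2 w.2 z.2) := by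
  have hξ : ∀ y, HasFDerivAt (fun u : E₁ × E₂ => ξ u.1) (ξ ∘L .fst ℝ E₁ E₂) y := fun y =>
    ξ.hasFDerivAt.comp y hasFDerivAt_fst
  have hJn : ∀ t ∈ J, J ∈ 𝓝 t := fun t ht => D.isOpen_interval.mem_nhds ht
  have h1 : ∀ y : E₁ × E₂, ξ y.1 ∈ J → fderiv ℝ (fun y : E₁ × E₂ => h (ξ y.1)) y =
      deriv h (ξ y.1) • (ξ ∘L .fst ℝ E₁ E₂) := fun y hy =>
    ((((hh.contDiffAt (hJn _ hy)).differentiableAt (by simp)).hasDerivAt).comp_hasFDerivAt y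
      (hξ y)).fderiv
  have h2 : fderiv ℝ (fun y : E₁ × E₂ => h (ξ y.1)) =ᶠ[𝓝 u] fun y =>
      deriv h (ξ y.1) • (ξ ∘L .fst ℝ E₁ E₂) := by
    filter_upwards [D.mem_nhds hJ hV] with y hy using h1 y hy.1
  have h3 : DifferentiableAt ℝ (deriv h) (ξ u.1) :=
    (((contDiffOn_infty_iff_deriv_of_isOpen D.isOpen_interval).1 hh).2.contDiffAt
      (hJn _ hJ)).differentiableAt (by simp)
  have h4 := (h3.hasDerivAt.comp_hasFDerivAt u (hξ u)).smul_const (ξ ∘L .fst ℝ E₁ E₂)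
  simp only [Function.comp_def] at h4
  rw [localHessian, h2.fderiv_eq, h4.fderiv, h1 u hJ, D.christoffel_warped hJ hV]
  simp
  ring

/-- The steady soliton equation for `warpedForm g₀ ξ φ f GF` and the potential `h ∘ ξ`, when the
fibre is Ricci-flat at the point. With `x = f'/f` and `φ'/φ = k x`, the three components of the
equation (along `ξ ⊗ ξ`, along `g₀` and along the fibre) reduce to `x' = z x²` and
`z' = -x ((z + k)² - S²)`, where `S² = m + k² (n - 1)`. -/
theorem localRicci_add_localHessian_eq_zero {k : ℝ} (hPX : P = fun t => k * X t) {z h : ℝ → ℝ}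
    (hh : ContDiffOn ℝ ∞ h J)
    (hz : ∀ t ∈ J, HasDerivAt z (-X t * ((z t + k) ^ 2
      - (Module.finrank ℝ E₂ + k ^ 2 * (Module.finrank ℝ E₁ - 1)))) t)
    (hX : ∀ t ∈ J, HasDerivAt X (z t * X t ^ 2) t)
    (hh' : ∀ t ∈ J, deriv h t =
      (z t + Module.finrank ℝ E₂ - k * (Module.finrank ℝ E₁ - 2)) * X t)
    (hJ : ξ u.1 ∈ J) (hV : u.2 ∈ V) (hflat : ∀ v w, localRicci GF u.2 v w = 0)
    (v w : E₁ × E₂) :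
    localRicci (warpedForm g₀ ξ φ f GF) u v w
      + localHessian (warpedForm g₀ ξ φ f GF) (fun y => h (ξ y.1)) u v w = 0 := by
  have hP : HasDerivAt P (k * (z (ξ u.1) * X (ξ u.1) ^ 2)) (ξ u.1) := by
    rw [hPX]
    exact (hX _ hJ).const_mul k
  have hh2 : deriv (deriv h) (ξ u.1) = _ :=
    (Filter.EventuallyEq.deriv_eq
      (Filter.eventually_of_mem (D.isOpen_interval.mem_nhds hJ) hh')).trans
      ((((hz _ hJ).add_const _).sub_const _).fun_mul (hX _ hJ)).deriv
  rw [D.localRicci_warped hJ hV hP (hX _ hJ), D.localHessian_warped hJ hV hh, hflat, hh2,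
    hh' _ hJ, hPX]
  ring

end IsWarpedData

end LocalWarped

/-! ### The ordinary differential equations -/

section Profile

variable {J : Set ℝ}

/-- A differentiable solution of a linear equation `f' = x f` with smooth coefficient is smooth. -/
theorem contDiffOn_of_deriv_eq_mul (hJ : IsOpen J) {x f : ℝ → ℝ} (hx : ContDiffOn ℝ ∞ x J)
    (hf : DifferentiableOn ℝ f J) (h : ∀ t ∈ J, deriv f t = x t * f t) : ContDiffOn ℝ ∞ f J := by
  refine contDiffOn_infty.2 fun n => ?_
  induction n with
  | zero => exact contDiffOn_zero.2 hf.continuousOn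
  | succ n ih =>
    push_cast
    refine (contDiffOn_succ_iff_deriv_of_isOpen hJ).2 ⟨hf, by simp, ?_⟩
    exact (((contDiffOn_infty.1 hx n).mul ih)).congr h

/-- Differentiating `x = c (z + k - S)^((a-1)/2) (z + k + S)^(-(a+1)/2)` along
`z' = -c (z + k - S)^((a+1)/2) (z + k + S)^(-(a-1)/2)`, where `a S = k`, gives `x' = z x²` and
`z' = -x ((z + k)² - S²)`. -/
theorem hasDerivAt_profile (hJ : IsOpen J) {x z : ℝ → ℝ} {a k c S : ℝ} (hS : 0 < S)
    (ha : a = k / S) (hz : DifferentiableOn ℝ z J) (hpos : ∀ t ∈ J, 0 < z t + k - S)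
    (hxz : ∀ t ∈ J, x t = c * (z t + k - S) ^ ((a - 1) / 2) * (z t + k + S) ^ (-(a + 1) / 2))
    (hode : ∀ t ∈ J, deriv z t =
      -c * (z t + k - S) ^ ((a + 1) / 2) * (z t + k + S) ^ (-(a - 1) / 2)) {t : ℝ} (ht : t ∈ J) :
    HasDerivAt z (-x t * ((z t + k) ^ 2 - S ^ 2)) t ∧ HasDerivAt x (z t * x t ^ 2) t := by
  have hm := hpos t ht
  have hp : 0 < z t + k + S := by linarith
  have haS : a * S = k := by rw [ha]; field_simp
  have h1 : HasDerivAt z (-x t * ((z t + k) ^ 2 - S ^ 2)) t := by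
    refine ((hz.differentiableAt (hJ.mem_nhds ht)).hasDerivAt).congr_deriv ?_
    rw [hode t ht, hxz t ht, show (a + 1) / 2 = (a - 1) / 2 + 1 by ring,
      show -(a - 1) / 2 = -(a + 1) / 2 + 1 by ring, Real.rpow_add hm, Real.rpow_add hp,
      Real.rpow_one, Real.rpow_one]
    ring
  refine ⟨h1, ?_⟩
  have h2 := (((h1.add_const k).sub_const S).rpow_const (p := (a - 1) / 2)
    (Or.inl hm.ne')).const_mul c
  have h3 := ((h1.add_const k).add_const S).rpow_const (p := -(a + 1) / 2) (Or.inl hp.ne')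
  have h4 := (h2.mul h3).congr_of_eventuallyEq
    (f₁ := x) (Filter.eventually_of_mem (hJ.mem_nhds ht) hxz)
  refine h4.congr_deriv ?_
  rw [Real.rpow_sub_one hm.ne', Real.rpow_sub_one hp.ne']
  have hx := hxz t ht
  set p := (z t + k - S) ^ ((a - 1) / 2)
  set q := (z t + k + S) ^ (-(a + 1) / 2)
  rw [show z t * x t ^ 2 = x t * (c * p * q) * z t by rw [← hx]; ring]
  field_simp
  rw [← haS]
  ring

end Profile

/-! ### Metrics in the preferred charts -/

section Chart

variable {E : Type*} [NormedAddCommGroup E] [NormedSpace ℝ E]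
  {H : Type*} [TopologicalSpace H] {I : ModelWithCorners ℝ E H} [I.Boundaryless]
  {M : Type*} [TopologicalSpace M] [ChartedSpace H M] [IsManifold I ∞ M]
  {E' : Type*} [NormedAddCommGroup E'] [NormedSpace ℝ E']
  {H' : Type*} [TopologicalSpace H'] {I' : ModelWithCorners ℝ E' H'} [I'.Boundaryless]
  {M' : Type*} [TopologicalSpace M'] [ChartedSpace H' M'] [IsManifold I' ∞ M']

theorem mdifferentiableAt_extChartAt_symm {p : M} {u : E} (hu : u ∈ (extChartAt I p).target) :
    MDifferentiableAt 𝓘(ℝ, E) I (extChartAt I p).symm u := by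
  have : IsManifold I 1 M := .of_le (n := ∞) (by simp)
  have h := mdifferentiableWithinAt_extChartAt_symm hu
  rwa [I.range_eq_univ, mdifferentiableWithinAt_univ] at h

theorem isInvertible_mfderiv_extChartAt_symm {p : M} {u : E} (hu : u ∈ (extChartAt I p).target) :
    (mfderiv 𝓘(ℝ, E) I (extChartAt I p).symm u).IsInvertible := by
  have : IsManifold I 1 M := .of_le (n := ∞) (by simp)
  have h := isInvertible_mfderivWithin_extChartAt_symm hu
  rwa [I.range_eq_univ, mfderivWithin_univ] at h

/-- The type ascription identifies the tangent space at `(extChartAt I p).symm (extChartAt I p p)`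
with that at `p`; both are `E`. -/
theorem mfderiv_extChartAt_symm_mfderiv_extChartAt (p : M) (v : TangentSpace I p) :
    (mfderiv 𝓘(ℝ, E) I (extChartAt I p).symm (extChartAt I p p)
      (mfderiv I 𝓘(ℝ, E) (extChartAt I p) p v) : E) = v := by
  have : IsManifold I 1 M := .of_le (n := ∞) (by simp)
  have h := mfderivWithin_extChartAt_symm_comp_mfderiv_extChartAt' (I := I)
    (mem_extChartAt_source (I := I) p)
  rw [I.range_eq_univ, mfderivWithin_univ] at h
  exact congrArg (fun T : E →L[ℝ] E => T v) h

omit [I.Boundaryless] in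
theorem surjective_mfderiv_extChartAt (p : M) :
    Function.Surjective (mfderiv I 𝓘(ℝ, E) (extChartAt I p) p) := by
  have : IsManifold I 1 M := .of_le (n := ∞) (by simp)
  obtain ⟨e, he⟩ := isInvertible_mfderiv_extChartAt (I := I) (mem_extChartAt_source (I := I) p)
  rw [← he]
  exact e.surjective

omit [I.Boundaryless] in
/-- Ricci-flatness in coordinates at the centre of a chart, for all coordinate vectors: each is the
image of a tangent vector. -/
theorem localRicci_chartMetric_eq_zero {g : BilinField I M} (hg : IsRicciFlat g) (p : M)
    (v w : E) : localRicci (chartMetric g p) (extChartAt I p p) v w = 0 := by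
  obtain ⟨v', rfl⟩ := surjective_mfderiv_extChartAt (I := I) p v
  obtain ⟨w', rfl⟩ := surjective_mfderiv_extChartAt (I := I) p w
  exact hg p v' w'

theorem chartMetric_extChartAt (g : BilinField I M) (p : M) (v w : TangentSpace I p) :
    chartMetric g p (extChartAt I p p) (mfderiv I 𝓘(ℝ, E) (extChartAt I p) p v)
      (mfderiv I 𝓘(ℝ, E) (extChartAt I p) p w) = g p v w := by
  have h : ∀ q : M, q = p → ∀ v' w' : E, g q v' w' = g p v' w' := by
    rintro q rfl _ _
    rfl
  exact (h _ (extChartAt_to_inv (I := I) p) _ _).trans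
    (congrArg₂ (fun s t : E => g p s t) (mfderiv_extChartAt_symm_mfderiv_extChartAt p v)
      (mfderiv_extChartAt_symm_mfderiv_extChartAt p w))

omit [I.Boundaryless] [IsManifold I ∞ M] in
theorem chartMetric_symm {g : BilinField I M} (hg : IsSemiRiemannianMetric g) (p : M) (u v w : E) :
    chartMetric g p u v w = chartMetric g p u w v :=
  hg.symm _ _ _

theorem chartMetric_nondegenerate {g : BilinField I M} (hg : IsSemiRiemannianMetric g) {p : M}
    {u : E} (hu : u ∈ (extChartAt I p).target) (v : E) (hv : ∀ w, chartMetric g p u v w = 0) :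
    v = 0 := by
  obtain ⟨e, he⟩ := isInvertible_mfderiv_extChartAt_symm hu
  have hinj : Function.Injective (mfderiv 𝓘(ℝ, E) I (extChartAt I p).symm u) :=
    he ▸ e.injective
  have hsurj : Function.Surjective (mfderiv 𝓘(ℝ, E) I (extChartAt I p).symm u) :=
    he ▸ e.surjective
  refine hinj ((hg.nondegenerate _ _ fun w => ?_).trans (map_zero _).symm)
  obtain ⟨w', rfl⟩ := hsurj w
  exact hv w'

/-- In a product chart the warped product splits as in the definition of a warped product. -/
theorem chartMetric_warpedProduct (gB : BilinField I M) (f : M → ℝ) (gF : BilinField I' M')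
    {p : M × M'} {u : E × E'} (hu : u ∈ (extChartAt (I.prod I') p).target) (v w : E × E') :
    chartMetric (warpedProduct gB f gF) p u v w =
      chartMetric gB p.1 u.1 v.1 w.1
        + f ((extChartAt I p.1).symm u.1) ^ 2 * chartMetric gF p.2 u.2 v.2 w.2 := by
  have hu1 : u.1 ∈ (extChartAt I p.1).target := by rw [extChartAt_prod] at hu; exact hu.1
  have hu2 : u.2 ∈ (extChartAt I' p.2).target := by rw [extChartAt_prod] at hu; exact hu.2
  have hd := mdifferentiableAt_extChartAt_symm hu
  have h1 : ∀ v, mfderiv (I.prod I') I Prod.fst ((extChartAt (I.prod I') p).symm u)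
      (mfderiv 𝓘(ℝ, E × E') (I.prod I') (extChartAt (I.prod I') p).symm u v)
      = mfderiv 𝓘(ℝ, E) I (extChartAt I p.1).symm u.1 v.1 := by
    intro v
    rw [← mfderiv_comp_apply _ mdifferentiableAt_fst hd]
    have h : (Prod.fst ∘ (extChartAt (I.prod I') p).symm) = (extChartAt I p.1).symm ∘ Prod.fst :=
      rfl
    rw [h, mfderiv_comp_apply (I' := 𝓘(ℝ, E)) _ (mdifferentiableAt_extChartAt_symm hu1)
      differentiableAt_fst.mdifferentiableAt, mfderiv_eq_fderiv, fderiv_fst]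
    rfl
  have h2 : ∀ v, mfderiv (I.prod I') I' Prod.snd ((extChartAt (I.prod I') p).symm u)
      (mfderiv 𝓘(ℝ, E × E') (I.prod I') (extChartAt (I.prod I') p).symm u v)
      = mfderiv 𝓘(ℝ, E') I' (extChartAt I' p.2).symm u.2 v.2 := by
    intro v
    rw [← mfderiv_comp_apply _ mdifferentiableAt_snd hd]
    have h : (Prod.snd ∘ (extChartAt (I.prod I') p).symm) = (extChartAt I' p.2).symm ∘ Prod.snd :=
      rfl
    rw [h, mfderiv_comp_apply (I' := 𝓘(ℝ, E')) _ (mdifferentiableAt_extChartAt_symm hu2)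
      differentiableAt_snd.mdifferentiableAt, mfderiv_eq_fderiv, fderiv_snd]
    rfl
  exact congrArg₂ (· + ·)
    (congrArg₂ (fun s t : E => gB ((extChartAt I p.1).symm u.1) s t) (h1 v) (h1 w))
    (congrArg (f ((extChartAt I p.1).symm u.1) ^ 2 * ·)
      (congrArg₂ (fun s t : E' => gF ((extChartAt I' p.2).symm u.2) s t) (h2 v) (h2 w)))

end Chart

section Base

variable {n : ℕ} {ε α : Fin n → ℝ} {J : TopologicalSpace.Opens ℝ} {φ : ℝ → ℝ}

/-- The preferred charts of the slab are its inclusion into `ℝⁿ`. -/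
theorem extChartAt_slab_symm {p : slab α J} {u : EuclideanSpace ℝ (Fin n)}
    (hu : u ∈ (extChartAt (𝓡 n) p).target) :
    (((extChartAt (𝓡 n) p).symm u : slab α J) :
      EuclideanSpace ℝ (Fin n)) = u :=
  (extChartAt (𝓡 n) p).right_inv hu

theorem chartMetric_conformalMetric {p : slab α J} {u : EuclideanSpace ℝ (Fin n)}
    (hu : u ∈ (extChartAt (𝓡 n) p).target)
    (v w : EuclideanSpace ℝ (Fin n)) :
    chartMetric (conformalMetric ε α J φ) p u v w =
      1 / φ (xi α u) ^ 2 * ∑ i, ε i * (v i * w i) := by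
  have hd := mdifferentiableAt_extChartAt_symm hu
  have h : ∀ v, mfderiv (𝓡 n) (𝓡 n)
      (Subtype.val : slab α J → EuclideanSpace ℝ (Fin n))
      ((extChartAt (𝓡 n) p).symm u)
      (mfderiv (𝓡 n) (𝓡 n)
        (extChartAt (𝓡 n) p).symm u v) = v := by
    intro v
    rw [← mfderiv_comp_apply _ ((contMDiff_subtype_val (n := 1)).mdifferentiable one_ne_zero _) hd]
    have h : (Subtype.val ∘ (extChartAt (𝓡 n) p).symm) =ᶠ[𝓝 u] id :=
      Filter.eventually_of_mem ((isOpen_extChartAt_target p).mem_nhds hu)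
        fun y hy => extChartAt_slab_symm hy
    rw [h.mfderiv_eq, mfderiv_id]
    rfl
  have h1 : chartMetric (conformalMetric ε α J φ) p u v w =
      1 / φ (xi α ((extChartAt (𝓡 n) p).symm u)) ^ 2
        * pseudoEuclidean ε 0 v w :=
    congrArg (1 / φ (xi α ((extChartAt (𝓡 n) p).symm u)) ^ 2 * ·)
      (congrArg₂ (fun s t : EuclideanSpace ℝ (Fin n) => pseudoEuclidean ε 0 s t) (h v) (h w))
  rw [h1, extChartAt_slab_symm hu, pseudoEuclidean_apply]

end Base

/-! ### The warped product over a slab of pseudo-Euclidean space -/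

section Soliton

variable {n m : ℕ} {ε α : Fin n → ℝ} {J : TopologicalSpace.Opens ℝ} {φ f P X : ℝ → ℝ}
  {F : Type*} [TopologicalSpace F] [ChartedSpace (EuclideanSpace ℝ (Fin m)) F]
  {gF : BilinField (𝓡 m) F}

/-- `xi α` as a continuous linear form. -/
noncomputable def xiL (α : Fin n → ℝ) : EuclideanSpace ℝ (Fin n) →L[ℝ] ℝ :=
  ∑ i, α i • (EuclideanSpace.proj i : EuclideanSpace ℝ (Fin n) →L[ℝ] ℝ)

theorem xiL_apply (α : Fin n → ℝ) (x : EuclideanSpace ℝ (Fin n)) : xiL α x = xi α x := by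
  simp [xiL, xi]

/-- The pseudo-Euclidean metric as a constant bilinear form on the vector space `ℝⁿ`. -/
noncomputable def pseudoEuclideanForm (ε : Fin n → ℝ) :
    EuclideanSpace ℝ (Fin n) →L[ℝ] EuclideanSpace ℝ (Fin n) →L[ℝ] ℝ :=
  pseudoEuclidean ε 0

theorem pseudoEuclideanForm_apply (ε : Fin n → ℝ) (v w : EuclideanSpace ℝ (Fin n)) :
    pseudoEuclideanForm ε v w = ∑ i, ε i * (v i * w i) :=
  pseudoEuclidean_apply ε 0 v w

/-- The coordinate expression of the warped product in the product chart at `(p, q)` satisfies the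
assumptions of the computation in coordinates. The gradient of `ξ` has components `ε i * α i`
because `ε i ^ 2 = 1`. -/
theorem isWarpedData [IsManifold (𝓡 m) ∞ F]
    (hε : ∀ i, ε i = 1 ∨ ε i = -1) (hgF : IsSemiRiemannianMetric gF)
    (hφ : ContDiffOn ℝ ∞ φ J) (hf : ContDiffOn ℝ ∞ f J) (hφ0 : ∀ t ∈ J, φ t ≠ 0)
    (hf0 : ∀ t ∈ J, f t ≠ 0) (hφ' : ∀ t ∈ J, deriv φ t = P t * φ t)
    (hf' : ∀ t ∈ J, deriv f t = X t * f t) (q : F) :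
    IsWarpedData (pseudoEuclideanForm ε) (xiL α) (WithLp.toLp 2 fun i => ε i * α i) (J : Set ℝ)
      φ f P X (extChartAt (𝓡 m) q).target (chartMetric gF q) where
  base_symm v w := by
    simp only [pseudoEuclideanForm_apply, mul_comm (v _)]
  base_nondegenerate v hv := by
    ext i
    have h := hv (EuclideanSpace.single i 1)
    have hi : ε i ≠ 0 := by rcases hε i with h | h <;> simp [h]
    simpa [pseudoEuclideanForm_apply, hi] using h
  gradient w := by
    rw [pseudoEuclideanForm_apply, xiL_apply, xi]
    refine Finset.sum_congr rfl fun i _ => ?_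
    rcases hε i with h | h <;> simp [h]
  isOpen_interval := J.isOpen
  smooth_conformal := hφ
  smooth_warping := hf
  conformal_ne_zero := hφ0
  warping_ne_zero := hf0
  deriv_conformal t ht := by
    rw [← hφ' t ht]
    exact ((hφ.contDiffAt (J.isOpen.mem_nhds ht)).differentiableAt (by simp)).hasDerivAt
  deriv_warping t ht := by
    rw [← hf' t ht]
    exact ((hf.contDiffAt (J.isOpen.mem_nhds ht)).differentiableAt (by simp)).hasDerivAt
  isOpen_fiber := isOpen_extChartAt_target q
  smooth_fiber := hgF.smooth q
  fiber_symm y _ v w := chartMetric_symm hgF q y v w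
  fiber_nondegenerate y hy v hv := chartMetric_nondegenerate hgF hy v hv

theorem xiL_mem_of_mem_target {p : slab α J × F}
    {u : EuclideanSpace ℝ (Fin n) × EuclideanSpace ℝ (Fin m)}
    (hu : u ∈ (extChartAt ((𝓡 n).prod (𝓡 m)) p).target) :
    xiL α u.1 ∈ J ∧ u.2 ∈ (extChartAt (𝓡 m) p.2).target := by
  rw [extChartAt_prod] at hu
  refine ⟨?_, hu.2⟩
  rw [xiL_apply, ← extChartAt_slab_symm hu.1]
  exact ((extChartAt (𝓡 n) p.1).symm u.1).2

/-- The equality holds on the whole target of the chart, hence as germs, which is what the Ricci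
tensor and the Hessian depend on. -/
theorem chartMetric_eq_warpedForm [IsManifold (𝓡 m) ∞ F]
    {p : slab α J × F} {u : EuclideanSpace ℝ (Fin n) × EuclideanSpace ℝ (Fin m)}
    (hu : u ∈ (extChartAt ((𝓡 n).prod (𝓡 m)) p).target) :
    chartMetric (warpedProduct (conformalMetric ε α J φ) (fun p => f (xi α p)) gF) p u =
      warpedForm (pseudoEuclideanForm ε) (xiL α) φ f (chartMetric gF p.2) u := by
  have hu1 : u.1 ∈ (extChartAt (𝓡 n) p.1).target := by
    rw [extChartAt_prod] at hu; exact hu.1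
  refine ContinuousLinearMap.ext fun v => ContinuousLinearMap.ext fun w => ?_
  rw [chartMetric_warpedProduct _ _ _ hu, chartMetric_conformalMetric hu1, warpedForm_apply,
    extChartAt_slab_symm hu1, pseudoEuclideanForm_apply, xiL_apply]

theorem isSemiRiemannianMetric_warpedProduct [IsManifold (𝓡 m) ∞ F]
    (hε : ∀ i, ε i = 1 ∨ ε i = -1) (hgF : IsSemiRiemannianMetric gF)
    (D : ∀ q : F, IsWarpedData (pseudoEuclideanForm ε) (xiL α)
      (WithLp.toLp 2 fun i => ε i * α i) (J : Set ℝ) φ f P X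
      (extChartAt (𝓡 m) q).target (chartMetric gF q)) :
    IsSemiRiemannianMetric
      (warpedProduct (conformalMetric ε α J φ) (fun p => f (xi α p)) gF) := by
  have hmem : ∀ p : slab α J × F, _ := fun p =>
    xiL_mem_of_mem_target (mem_extChartAt_target (I := (𝓡 n).prod (𝓡 m)) p)
  have hinv : ∀ p : slab α J × F,
      ∃ e : TangentSpace ((𝓡 n).prod (𝓡 m)) p
        ≃L[ℝ] EuclideanSpace ℝ (Fin n) × EuclideanSpace ℝ (Fin m), ∀ v w,
      warpedProduct (conformalMetric ε α J φ) (fun p => f (xi α p)) gF p v w =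
        warpedForm (pseudoEuclideanForm ε) (xiL α) φ f (chartMetric gF p.2)
          (extChartAt ((𝓡 n).prod (𝓡 m)) p p)
          (e v) (e w) := by
    intro p
    obtain ⟨e, he⟩ := isInvertible_mfderiv_extChartAt
      (I := (𝓡 n).prod (𝓡 m))
      (mem_extChartAt_source p)
    refine ⟨e, fun v w => ?_⟩
    rw [← chartMetric_eq_warpedForm (mem_extChartAt_target p)]
    refine (chartMetric_extChartAt _ p v w).symm.trans ?_
    rw [← he]
    rfl
  have hinvF : ∀ q : F,
      ∃ e : TangentSpace (𝓡 m) q ≃L[ℝ] EuclideanSpace ℝ (Fin m),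
      ∀ v w, chartMetric gF q (extChartAt (𝓡 m) q q) (e v) (e w) =
        gF q v w := by
    intro q
    obtain ⟨e, he⟩ := isInvertible_mfderiv_extChartAt
      (I := 𝓡 m) (mem_extChartAt_source q)
    refine ⟨e, fun v w => ?_⟩
    rw [← chartMetric_extChartAt gF q v w, ← he]
    rfl
  refine ⟨fun p v w => ?_, fun p v hv => ?_, fun p => ?_, ?_⟩
  · obtain ⟨e, he⟩ := hinv p
    rw [he, he, warpedForm_apply, warpedForm_apply, (D p.2).base_symm,
      (D p.2).fiber_symm _ (hmem p).2]
  · obtain ⟨e, he⟩ := hinv p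
    refine e.injective (((D p.2).nondegenerate (hmem p).1 (hmem p).2 _ fun w => ?_).trans
      (map_zero e).symm)
    have h := hv (e.symm w)
    rwa [he, e.apply_symm_apply] at h
  · refine ((D p.2).contDiffOn.mono fun u hu => ?_).congr fun u hu => chartMetric_eq_warpedForm hu
    exact xiL_mem_of_mem_target hu
  · obtain ⟨ι, _, η, hη, hb⟩ := hgF.constant_index
    refine ⟨Fin n ⊕ ι, inferInstance, Sum.elim ε η, ?_, fun p => ?_⟩
    · rintro (i | i)
      exacts [hε i, hη i]
    obtain ⟨b, hb1, hb2⟩ := hb p.2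
    obtain ⟨e, he⟩ := hinv p
    obtain ⟨eF, heF⟩ := hinvF p.2
    have hφ0 := (D p.2).conformal_ne_zero _ (hmem p).1
    have hf0 := (D p.2).warping_ne_zero _ (hmem p).1
    set u := extChartAt ((𝓡 n).prod (𝓡 m)) p p
    have hu2 : u.2 = extChartAt (𝓡 m) p.2 p.2 := rfl
    -- rescaling by `φ` and `1 / f` turns orthonormal bases of `g₀` and `gF` into one for the
    -- warped product
    let b₁ := (EuclideanSpace.basisFun (Fin n) ℝ).toBasis.unitsSMul
      fun _ => Units.mk0 (φ (xiL α u.1)) hφ0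
    let b₂ := (b.map eF.toLinearEquiv).unitsSMul
      fun _ => (Units.mk0 (f (xiL α u.1)) hf0)⁻¹
    have hb₁ : ∀ i, b₁ i = φ (xiL α u.1) • EuclideanSpace.single i 1 := fun i => by
      simp [b₁, Module.Basis.unitsSMul_apply, Units.smul_def]
    have hb₂ : ∀ i, b₂ i = (f (xiL α u.1))⁻¹ • eF (b i) := fun i => by
      simp [b₂, Module.Basis.unitsSMul_apply, Units.smul_def]
    have h1 : ∀ i j, pseudoEuclideanForm ε (b₁ i) (b₁ j) =
        if i = j then ε i * φ (xiL α u.1) ^ 2 else 0 := by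
      intro i j
      rw [hb₁, hb₁]
      simp only [map_smul, smul_apply, smul_eq_mul, pseudoEuclideanForm_apply]
      split_ifs with h
      · simp [h]
        ring
      · simp [Ne.symm h]
    have h2 : ∀ i j, chartMetric gF p.2 u.2 (b₂ i) (b₂ j) =
        (f (xiL α u.1) ^ 2)⁻¹ * gF p.2 (b i) (b j) := by
      intro i j
      rw [hb₂, hb₂, hu2]
      simp only [map_smul, smul_apply, smul_eq_mul, heF]
      ring
    refine ⟨(b₁.prod b₂).map e.symm.toLinearEquiv, ?_, ?_⟩
    · rintro (i | i)
      · simp [he, warpedForm_apply, h1]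
        field_simp
      · simp [he, warpedForm_apply, h2, hb1, hf0]
    · rintro (i | i) (j | j) hij
      · have hij' : i ≠ j := fun h => hij (h ▸ rfl)
        simp [he, warpedForm_apply, h1, hij']
      · simp [he, warpedForm_apply]
      · simp [he, warpedForm_apply]
      · have hij' : i ≠ j := fun h => hij (h ▸ rfl)
        simp [he, warpedForm_apply, h2, hb2 i j hij']

end Soliton

end SemiRiem

theorem theorem1p5 {n m : ℕ} (hn : 3 ≤ n) (hm : 1 ≤ m)
    (ε : Fin n → ℝ) (hε : ∀ i, ε i = 1 ∨ ε i = -1)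
    (α : Fin n → ℝ) (hα : ∑ i, ε i * α i ^ 2 = 1 ∨ ∑ i, ε i * α i ^ 2 = -1)
    {F : Type*} [TopologicalSpace F] [ChartedSpace (EuclideanSpace ℝ (Fin m)) F]
    [IsManifold 𝓘(ℝ, EuclideanSpace ℝ (Fin m)) ∞ F]
    (gF : SemiRiem.BilinField 𝓘(ℝ, EuclideanSpace ℝ (Fin m)) F)
    (hgF : SemiRiem.IsSemiRiemannianMetric gF) (hflat : SemiRiem.IsRicciFlat gF)
    (a k c₃ : ℝ) (hk : 0 < k) (hc₃ : 0 < c₃)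
    (ha : a = k / √((m : ℝ) + k ^ 2 * ((n : ℝ) - 1)))
    (J : TopologicalSpace.Opens ℝ) (x z φ f h : ℝ → ℝ)
    (hx : ContDiffOn ℝ ∞ x (J : Set ℝ)) (hz : ContDiffOn ℝ ∞ z (J : Set ℝ))
    (hpos : ∀ ξ ∈ J, 0 < z ξ + k - √((m : ℝ) + k ^ 2 * ((n : ℝ) - 1)))
    (hxz : ∀ ξ ∈ J, x ξ =
      c₃ * (z ξ + k - √((m : ℝ) + k ^ 2 * ((n : ℝ) - 1))) ^ ((a - 1) / 2)
        * (z ξ + k + √((m : ℝ) + k ^ 2 * ((n : ℝ) - 1))) ^ (-(a + 1) / 2))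
    (hode : ∀ ξ ∈ J, deriv z ξ =
      -c₃ * (z ξ + k - √((m : ℝ) + k ^ 2 * ((n : ℝ) - 1))) ^ ((a + 1) / 2)
        * (z ξ + k + √((m : ℝ) + k ^ 2 * ((n : ℝ) - 1))) ^ (-(a - 1) / 2))
    (hφ0 : ∀ ξ ∈ J, φ ξ ≠ 0) (hf0 : ∀ ξ ∈ J, 0 < f ξ)
    (hφd : DifferentiableOn ℝ φ (J : Set ℝ)) (hfd : DifferentiableOn ℝ f (J : Set ℝ))
    (hhd : DifferentiableOn ℝ h (J : Set ℝ))
    (hφ : ∀ ξ ∈ J, deriv φ ξ / φ ξ = k * (deriv f ξ / f ξ))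
    (hf : ∀ ξ ∈ J, deriv f ξ / f ξ = x ξ)
    (hh : ∀ ξ ∈ J, deriv h ξ = (z ξ + (m : ℝ) - k * ((n : ℝ) - 2)) * x ξ) :
    SemiRiem.IsSteadyGradientRicciSoliton
      (SemiRiem.warpedProduct (SemiRiem.conformalMetric ε α J φ)
        (fun p => f (SemiRiem.xi α p)) gF)
      (fun q : SemiRiem.slab α J × F => h (SemiRiem.xi α q.1)) := by
  have hJ := J.isOpen
  have hn' : (1 : ℝ) ≤ (n : ℝ) - 1 := by
    have : (3 : ℝ) ≤ n := by exact_mod_cast hn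
    linarith
  have hS2 : 0 < (m : ℝ) + k ^ 2 * ((n : ℝ) - 1) := by positivity
  have hprof := fun t (ht : t ∈ (J : Set ℝ)) => SemiRiem.hasDerivAt_profile hJ
    (Real.sqrt_pos.2 hS2) ha (hz.differentiableOn (by simp)) hpos hxz hode ht
  rw [Real.sq_sqrt hS2.le] at hprof
  have hf' : ∀ t ∈ J, deriv f t = x t * f t := fun t ht => by
    rw [← hf t ht, div_mul_cancel₀ _ (hf0 t ht).ne']
  have hφ' : ∀ t ∈ J, deriv φ t = k * x t * φ t := fun t ht => by
    rw [← hf t ht, ← hφ t ht, div_mul_cancel₀ _ (hφ0 t ht)]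
  have hfs := SemiRiem.contDiffOn_of_deriv_eq_mul hJ hx hfd hf'
  have hφs := SemiRiem.contDiffOn_of_deriv_eq_mul hJ (contDiffOn_const.mul hx) hφd hφ'
  have hhs : ContDiffOn ℝ ∞ h J := (contDiffOn_infty_iff_deriv_of_isOpen hJ).2
    ⟨hhd, (((hz.add contDiffOn_const).sub contDiffOn_const).mul hx).congr hh⟩
  have D := fun q : F => SemiRiem.isWarpedData (α := α) hε hgF hφs hfs hφ0
    (fun t ht => (hf0 t ht).ne') hφ' hf' q
  refine ⟨SemiRiem.isSemiRiemannianMetric_warpedProduct hε hgF D, fun p => ?_, fun p v w => ?_⟩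
  · have h1 : ContMDiffAt 𝓘(ℝ, ℝ) 𝓘(ℝ, ℝ) ∞ h (SemiRiem.xi α p.1) :=
      (hhs.contDiffAt (hJ.mem_nhds p.1.2)).contMDiffAt
    have h2 : ContDiff ℝ ∞ (SemiRiem.xi α) := by
      rw [← funext (SemiRiem.xiL_apply α)]
      exact (SemiRiem.xiL α).contDiff
    exact h1.comp p ((h2.contMDiff.comp contMDiff_subtype_val).comp contMDiff_fst p)
  · have hp := mem_extChartAt_target (I := (𝓡 n).prod (𝓡 m)) p
    have hnhds := (isOpen_extChartAt_target p).mem_nhds hp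
    have hG : SemiRiem.chartMetric (SemiRiem.warpedProduct (SemiRiem.conformalMetric ε α J φ)
        (fun p => f (SemiRiem.xi α p)) gF) p =ᶠ[nhds (extChartAt ((𝓡 n).prod (𝓡 m)) p p)] _ :=
      Filter.eventually_of_mem hnhds fun u hu => SemiRiem.chartMetric_eq_warpedForm hu
    have hpot : (fun q : SemiRiem.slab α J × F => h (SemiRiem.xi α q.1)) ∘
        (extChartAt ((𝓡 n).prod
          (𝓡 m)) p).symm =ᶠ[nhds (extChartAt ((𝓡 n).prod (𝓡 m)) p p)]
        fun u => h (SemiRiem.xiL α u.1) := by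
      refine Filter.eventually_of_mem hnhds fun u hu => ?_
      dsimp only
      rw [SemiRiem.xiL_apply]
      rw [extChartAt_prod] at hu
      exact congrArg (fun y => h (SemiRiem.xi α y)) (SemiRiem.extChartAt_slab_symm hu.1)
    rw [SemiRiem.ricci, SemiRiem.hessian, SemiRiem.localRicci_congr hG,
      SemiRiem.localHessian_congr hG hpot, zero_mul]
    refine (D p.2).localRicci_add_localHessian_eq_zero rfl hhs (z := z) ?_ ?_ ?_
      (SemiRiem.xiL_mem_of_mem_target hp).1 (SemiRiem.xiL_mem_of_mem_target hp).2
      (SemiRiem.localRicci_chartMetric_eq_zero hflat p.2) _ _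
    · simpa only [finrank_euclideanSpace_fin] using fun t ht => (hprof t ht).1
    · exact fun t ht => (hprof t ht).2
    · simpa only [finrank_euclideanSpace_fin] using fun t (ht : t ∈ (J : Set ℝ)) => hh t ht
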